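/- Let $(\Omega,\mathcal F,\mathbb P)$ be a probability space with a filtration $(\mathcal F_k)_{k\ge 0}$, and let $L^k=[l^k_{ij}]$, $k=0,1,2,\dots$, be random $n\times n$ matrices such that $L^k$ is $\mathcal F_k$-measurable. Almost surely, suppose that every $L^k$ is a graph Laplacian, i.e. there is an entrywise nonnegative matrix $A=[a_{ij}]$ with $l^k_{ij}=-a_{ij}$ for $i\ne j$ and $l^k_{ii}=\sum_{j\neq i}a_{ij}$, and that $l^k_{\max}:=\max_i l^k_{ii}\in[l_{\min},l_{\max}]$ for all $k$, where $0<l_{\min}<l_{\max}$ are constants. Assume: (i) There is a constant $\delta\in(0,1/2)$ such that the (possibly random) update times $t_0,t_1,t_2,\dots$ almost surely satisfy $t_{k+1}-t_k\in[\delta/l^k_{\max},\,(1-\delta)/l^k_{\max}]$ for all $k$. (ii) There are constants $h\in\{1,2,\dots\}$ and $\delta'>0$ such that for every $k\ge 0$, almost surely, the graph corresponding to the conditional expectation $\mathbb E\{\sum_{m=k+1}^{k+h}L^m\mid\mathcal F_k\}=[\bar l_{ij}]$ has a $\delta'$-spanning tree; that is, the directed graph on $\{1,\dots,n\}$ with an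 edge from $j$ to $i$ ($j\ne i$) exactly when $-\bar l_{ij}\ge\delta'$ has a spanning subgraph that is a directed tree (a root without in-neighbours, every other vertex having exactly one in-neighbour, and a directed path from the root to every other vertex). Then the centralized self-triggered algorithm $$\dot x(t)=-L^k x(t_k),\qquad t\in[t_k,t_{k+1}),\quad k=0,1,2,\dots,$$ reaches consensus almost surely: for all continuous trajectories $x$ on $[t_0,\infty)$ with values in $\mathbb R^n$ that satisfy this equation (with the right derivative), from arbitrary, possibly random, initial values $x(t_0)$, almost surely there is $x^*\in\mathbb R$ with $\lim_{t\to\infty}x_i(t)=x^*$ for all $i=1,\dots,n$. -/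

import Mathlib

open MeasureTheory Filter Topology

namespace SelfTriggered

/-- A directed tree on the vertex set `V`: there is a root without in-neighbours, every other vertex
has exactly one in-neighbour, and every vertex is reached from the root by a directed path.
An edge `T.Adj u v` points from `u` to `v`. -/
def IsDirectedTree {V : Type*} (T : Digraph V) : Prop :=
  ∃ r : V, (∀ u, ¬ T.Adj u r) ∧ (∀ v, v ≠ r → ∃! u, T.Adj u v) ∧
    ∀ v, Relation.ReflTransGen T.Adj r v

/-- A digraph has a spanning tree if one of its spanning subgraphs is a directed tree
(the order on `Digraph V` is the spanning subgraph relation). -/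
def HasSpanningTree {V : Type*} (G : Digraph V) : Prop :=
  ∃ T : Digraph V, T ≤ G ∧ IsDirectedTree T

variable {n : ℕ}

/-- The digraph of a (nonnegative) weight matrix `A`: there is an edge from `j` to `i` if and only if
`A i j > 0`. -/
def graph (A : Matrix (Fin n) (Fin n) ℝ) : Digraph (Fin n) where
  Adj j i := 0 < A i j

/-- The `δ`-matrix of `A`: the entries smaller than `δ` are replaced by `0`. -/
noncomputable def deltaMatrix (δ : ℝ) (A : Matrix (Fin n) (Fin n) ℝ) :
    Matrix (Fin n) (Fin n) ℝ :=
  Matrix.of fun i j => if δ ≤ A i j then A i j else 0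

/-- The graph with weight matrix `A` has a `δ`-spanning tree: its `δ`-graph has a spanning tree. -/
def HasDeltaSpanningTree (δ : ℝ) (A : Matrix (Fin n) (Fin n) ℝ) : Prop :=
  HasSpanningTree (graph (deltaMatrix δ A))

/-- The graph Laplacian of the weight matrix `A`. -/
def laplacian (A : Matrix (Fin n) (Fin n) ℝ) : Matrix (Fin n) (Fin n) ℝ :=
  Matrix.of fun i j => if i = j then ∑ k ∈ Finset.univ.erase i, A i k else -A i j

/-- `M` is the graph Laplacian of some weighted digraph. -/
def IsLaplacian (M : Matrix (Fin n) (Fin n) ℝ) : Prop :=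
  ∃ A : Matrix (Fin n) (Fin n) ℝ, (∀ i j, 0 ≤ A i j) ∧ laplacian A = M

/-- The weight matrix (with zero diagonal) of the graph whose Laplacian is `M`. -/
def weightOfLaplacian (M : Matrix (Fin n) (Fin n) ℝ) : Matrix (Fin n) (Fin n) ℝ :=
  Matrix.of fun i j => if i = j then 0 else -M i j

/-- The largest diagonal entry of `M`. -/
noncomputable def maxDiag (M : Matrix (Fin n) (Fin n) ℝ) : ℝ := ⨆ i, M i i

/-- `x` is a solution on `[t 0, ∞)` of `x'(s) = -L k x(t k)` for `s ∈ [t k, t (k + 1))`: it is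
continuous, and its right derivative satisfies the equation on each interval. -/
structure IsSolution (L : ℕ → Matrix (Fin n) (Fin n) ℝ) (t : ℕ → ℝ) (x : ℝ → Fin n → ℝ) :
    Prop where
  continuousOn : ContinuousOn x (Set.Ici (t 0))
  hasDeriv : ∀ k, ∀ s ∈ Set.Ico (t k) (t (k + 1)),
    HasDerivWithinAt x (-(Matrix.mulVec (L k) (x (t k)))) (Set.Ici s) s

/-- All the components of `x` converge, as time tends to infinity, to a common real value. -/
def ReachesConsensus (x : ℝ → Fin n → ℝ) : Prop :=
  ∃ c : ℝ, ∀ i, Tendsto (fun s => x s i) atTop (𝓝 c)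

/-- The conditional expectation of a random matrix, entry by entry. -/
noncomputable def condExpMatrix {Ω : Type*} {mΩ : MeasurableSpace Ω} (μ : Measure Ω)
    (m : MeasurableSpace Ω) (X : Ω → Matrix (Fin n) (Fin n) ℝ) (ω : Ω) :
    Matrix (Fin n) (Fin n) ℝ :=
  Matrix.of fun i j => (μ[fun ω' => X ω' i j | m]) ω

end SelfTriggered

/-! Between updates the solution is affine, so `x (t (k+1)) = (I - τ L k) x (t k)` with `τ * maxDiag
(L k) ≤ 1 - δ`: an averaging step with self-weights at least `δ`, in which an edge of Laplacian
weight at least `η` gets weight at least `(δ / lmax) * η`. The minimum cannot decrease, nor the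
maximum increase, and if one vertex reaches all others in `T` steps, the spread shrinks by the
factor `1 - ε ^ T`. Consensus follows if this happens infinitely often
(`tendsto_of_frequently_reachesAll`).

Almost surely it does (`ae_frequently_reachesAll`). The root of the expected tree may change from
window to window, so the reached pairs are counted for all roots at once. As long as no vertex
reaches all, some tree edge leaves the set reached from the current root. Its conditional mean
weight over the next `h` graphs is at least `δ'`, so with conditional probability bounded below one
of them carries it with weight at least `δ' / (2h)`, and a pair is gained. After more windows than
there are pairs, some vertex must reach all. A Borel–Cantelli argument then gives infinitely many
successes. -/

namespace SelfTriggered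

/-! ### Reachability in a sequence of graphs. -/

section Reach

variable {ι : Type*} [Fintype ι] [DecidableEq ι]

open Classical in
/-- The pairs `(i, r)` such that `i` is reached from `r` along edges of the relations
`g s, …, g (s + m - 1)`, used in this order and with waiting allowed. -/
noncomputable def reach (g : ℕ → ι → ι → Prop) (s : ℕ) : ℕ → Finset (ι × ι)
  | 0 => Finset.univ.filter fun p => p.1 = p.2
  | m + 1 => Finset.univ.filter fun p =>
      p ∈ reach g s m ∨ ∃ j, (j, p.2) ∈ reach g s m ∧ g (s + m) p.1 j

/-- Some vertex reaches all the vertices during the `m` steps from `s` on. -/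
def ReachesAll (g : ℕ → ι → ι → Prop) (s m : ℕ) : Prop :=
  ∃ r, ∀ i, (i, r) ∈ reach g s m

variable {g : ℕ → ι → ι → Prop} {s m : ℕ}

theorem mem_reach_zero {p : ι × ι} : p ∈ reach g s 0 ↔ p.1 = p.2 := by
  simp [reach]

theorem mem_reach_succ {p : ι × ι} : p ∈ reach g s (m + 1) ↔
    p ∈ reach g s m ∨ ∃ j, (j, p.2) ∈ reach g s m ∧ g (s + m) p.1 j := by
  simp [reach]

theorem reach_mono : Monotone (reach g s) :=
  monotone_nat_of_le_succ fun _ _ hp => mem_reach_succ.2 (Or.inl hp)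

theorem refl_mem_reach (r : ι) : (r, r) ∈ reach g s m :=
  reach_mono (Nat.zero_le m) (mem_reach_zero.2 rfl)

theorem ReachesAll.mono {m' : ℕ} (hm : m ≤ m') (H : ReachesAll g s m) : ReachesAll g s m' :=
  H.imp fun _ hr i => reach_mono hm (hr i)

/-- Since waiting is allowed, `j` is still reached when the edge appears, however late in the
window. -/
theorem card_reach_lt {m' : ℕ} {i j r : ι} (hj : (j, r) ∈ reach g s m)
    (hi : (i, r) ∉ reach g s m) {q : ℕ} (hq : m ≤ q) (hq' : q < m') (hg : g (s + q) i j) :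
    (reach g s m).card < (reach g s m').card := by
  refine Finset.card_lt_card ((Finset.ssubset_iff_of_subset (reach_mono (hq.trans hq'.le))).2
    ⟨(i, r), reach_mono (Nat.succ_le_of_lt hq') ?_, hi⟩)
  exact mem_reach_succ.2 (Or.inr ⟨j, reach_mono hq hj, hg⟩)

end Reach

/-! ### Contraction of the spread under averaging steps. -/

section Contraction

variable {ι : Type*}

/-- One averaging step from `y` to `z` keeps every common lower bound and, along the edges of `g`
and the self-loops, retains the fraction `ε` of the distance to it. -/
def RetainsLower (ε : ℝ) (g : ι → ι → Prop) (y z : ι → ℝ) : Prop :=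
  ∀ lo : ℝ, (∀ j, lo ≤ y j) → ∀ i,
    ε * (y i - lo) ≤ z i - lo ∧ ∀ j, g i j → ε * (y j - lo) ≤ z i - lo

variable {ε : ℝ} {g : ℕ → ι → ι → Prop} {y : ℕ → ι → ℝ}

theorem RetainsLower.lower_bound (hε : 0 ≤ ε)
    (H : ∀ m, RetainsLower ε (g m) (y m) (y (m + 1))) {lo : ℝ} {s : ℕ} (hlo : ∀ j, lo ≤ y s j)
    (m : ℕ) : ∀ j, lo ≤ y (s + m) j := by
  induction m with
  | zero => exact hlo
  | succ m ih =>
    intro i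
    have h1 := (H (s + m) lo ih i).1
    have h2 := mul_nonneg hε (sub_nonneg.2 (ih i))
    rw [← add_assoc]
    linarith

variable [Fintype ι] [DecidableEq ι]

/-- Each step of a path costs one factor `ε`; waiting pays the same price through the self-loop. -/
theorem RetainsLower.reach (hε : 0 ≤ ε)
    (H : ∀ m, RetainsLower ε (g m) (y m) (y (m + 1))) {lo : ℝ} {s : ℕ} (hlo : ∀ j, lo ≤ y s j)
    {r : ι} (m : ℕ) : ∀ i, (i, r) ∈ reach g s m → ε ^ m * (y s r - lo) ≤ y (s + m) i - lo := by
  induction m with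
  | zero =>
    intro i hi
    obtain rfl : i = r := mem_reach_zero.1 hi
    simp
  | succ m ih =>
    intro i hi
    have hb := RetainsLower.lower_bound hε H hlo m
    rw [← add_assoc, pow_succ', mul_assoc]
    rcases mem_reach_succ.1 hi with h1 | ⟨j, h1, hg⟩
    · exact (mul_le_mul_of_nonneg_left (ih i h1) hε).trans (H (s + m) lo hb i).1
    · exact (mul_le_mul_of_nonneg_left (ih j h1) hε).trans ((H (s + m) lo hb i).2 j hg)

theorem tendsto_of_frequently_reachesAll [Nonempty ι] (hε : 0 < ε)
    (H : ∀ m, RetainsLower ε (g m) (y m) (y (m + 1)))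
    (H' : ∀ m, RetainsLower ε (g m) (-y m) (-y (m + 1)))
    {T : ℕ} (hT : ∃ᶠ s in atTop, ReachesAll g s T) :
    ∃ c : ℝ, Tendsto (fun m => ⨅ i, y m i) atTop (𝓝 c) ∧
      Tendsto (fun m => ⨆ i, y m i) atTop (𝓝 c) := by
  have hD : ∀ m i, (⨅ i, y m i) ≤ y m i := fun m i => ciInf_le (Set.finite_range _).bddBelow i
  have hU : ∀ m i, y m i ≤ ⨆ i, y m i := fun m i => le_ciSup (Set.finite_range _).bddAbove i
  have hUn : ∀ m i, -(⨆ i, y m i) ≤ (-y m) i := fun m i => neg_le_neg (hU m i)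
  have hDmono : Monotone fun m => ⨅ i, y m i := monotone_nat_of_le_succ fun m =>
    le_ciInf (RetainsLower.lower_bound hε.le H (hD m) 1)
  have hUanti : Antitone fun m => ⨆ i, y m i := antitone_nat_of_succ_le fun m =>
    ciSup_le fun i => neg_le_neg_iff.1
      (RetainsLower.lower_bound (y := fun m => -y m) hε.le H' (hUn m) 1 i)
  have hDU : ∀ m, (⨅ i, y m i) ≤ ⨆ i, y m i := fun m =>
    (hD m (Classical.arbitrary ι)).trans (hU m _)
  have hbD : BddAbove (Set.range fun m => ⨅ i, y m i) :=
    ⟨⨆ i, y 0 i, by rintro _ ⟨m, rfl⟩; exact (hDU m).trans (hUanti (Nat.zero_le m))⟩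
  have hbU : BddBelow (Set.range fun m => ⨆ i, y m i) :=
    ⟨⨅ i, y 0 i, by rintro _ ⟨m, rfl⟩; exact (hDmono (Nat.zero_le m)).trans (hDU m)⟩
  have tD := tendsto_atTop_ciSup hDmono hbD
  have tU := tendsto_atTop_ciInf hUanti hbU
  set c := ⨆ m, ⨅ i, y m i
  set c' := ⨅ m, ⨆ i, y m i
  have hcc' : c ≤ c' := le_of_tendsto_of_tendsto' tD tU hDU
  have hcontr : ∀ s, ReachesAll g s T → (⨆ i, y (s + T) i) - (⨅ i, y (s + T) i) -
      (1 - ε ^ T) * ((⨆ i, y s i) - ⨅ i, y s i) ≤ 0 := by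
    rintro s ⟨r, hr⟩
    have h1 : (⨅ i, y s i) + ε ^ T * (y s r - ⨅ i, y s i) ≤ ⨅ i, y (s + T) i :=
      le_ciInf fun i => by linarith [RetainsLower.reach hε.le H (hD s) T i (hr i)]
    have h2 : (⨆ i, y (s + T) i) ≤ (⨆ i, y s i) - ε ^ T * ((⨆ i, y s i) - y s r) :=
      ciSup_le fun i => by
        have := RetainsLower.reach (y := fun m => -y m) hε.le H' (hUn s) T i (hr i)
        simp only [Pi.neg_apply] at this
        linarith
    linarith
  have hlim : Tendsto (fun s => (⨆ i, y (s + T) i) - (⨅ i, y (s + T) i) -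
      (1 - ε ^ T) * ((⨆ i, y s i) - ⨅ i, y s i)) atTop
      (𝓝 ((c' - c) - (1 - ε ^ T) * (c' - c))) :=
    ((((tendsto_add_atTop_iff_nat T).2 tU).sub ((tendsto_add_atTop_iff_nat T).2 tD))).sub
      ((tU.sub tD).const_mul _)
  -- The extrema converge anyway, so the contraction inequality passes to the limit along the good
  -- times; these windows may overlap.
  have h0 : (c' - c) - (1 - ε ^ T) * (c' - c) ≤ 0 :=
    le_of_tendsto_of_frequently hlim (hT.mono hcontr)
  have h1 : c' - c ≤ 0 := by
    by_contra! hlt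
    have := mul_pos (pow_pos hε T) hlt
    linarith
  have h2 : c' = c := by linarith
  exact ⟨c, tD, h2 ▸ tU⟩

end Contraction

/-! ### One Euler step of a Laplacian. -/

section Laplacian

variable {n : ℕ} {M : Matrix (Fin n) (Fin n) ℝ}

theorem le_maxDiag (M : Matrix (Fin n) (Fin n) ℝ) (i : Fin n) : M i i ≤ maxDiag M :=
  le_ciSup (f := fun i => M i i) (Set.finite_range _).bddAbove i

theorem IsLaplacian.neg_apply_nonneg (hM : IsLaplacian M) {i j : Fin n} (hij : i ≠ j) :
    0 ≤ -M i j := by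
  obtain ⟨A, hA, rfl⟩ := hM
  simpa [laplacian, hij] using hA i j

theorem IsLaplacian.apply_self (hM : IsLaplacian M) (i : Fin n) :
    M i i = ∑ k ∈ Finset.univ.erase i, -M i k := by
  obtain ⟨A, hA, rfl⟩ := hM
  have : ∀ k ∈ Finset.univ.erase i, -laplacian A i k = A i k := fun k hk => by
    simp [laplacian, (Finset.ne_of_mem_erase hk).symm]
  rw [Finset.sum_congr rfl this]
  simp [laplacian]

theorem IsLaplacian.apply_self_nonneg (hM : IsLaplacian M) (i : Fin n) : 0 ≤ M i i := by
  rw [hM.apply_self]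
  exact Finset.sum_nonneg fun k hk => hM.neg_apply_nonneg (Finset.ne_of_mem_erase hk).symm

theorem IsLaplacian.neg_apply_le (hM : IsLaplacian M) (i j : Fin n) : -M i j ≤ maxDiag M := by
  have h1 := le_maxDiag M i
  have h2 := hM.apply_self_nonneg i
  by_cases hij : i = j
  · subst hij
    linarith
  · have h3 : -M i j ≤ M i i := by
      rw [hM.apply_self]
      exact Finset.single_le_sum (f := fun k => -M i k)
        (fun k hk => hM.neg_apply_nonneg (Finset.ne_of_mem_erase hk).symm) (by simp [Ne.symm hij])
    linarith

theorem IsLaplacian.abs_apply_le (hM : IsLaplacian M) (i j : Fin n) : |M i j| ≤ maxDiag M := by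
  by_cases hij : i = j
  · subst hij
    rw [abs_of_nonneg (hM.apply_self_nonneg i)]
    exact le_maxDiag M i
  · rw [← abs_neg, abs_of_nonneg (hM.neg_apply_nonneg hij)]
    exact hM.neg_apply_le i j

/-- Zero row sums allow the constant `lo` to be subtracted from every component. -/
theorem IsLaplacian.step_sub (hM : IsLaplacian M) (τ : ℝ) (y : Fin n → ℝ) (lo : ℝ) (i : Fin n) :
    (y - τ • M.mulVec y) i - lo = (1 - τ * M i i) * (y i - lo) +
      τ * ∑ k ∈ Finset.univ.erase i, -M i k * (y k - lo) := by
  have h1 : M.mulVec y i = M i i * y i + ∑ k ∈ Finset.univ.erase i, M i k * y k :=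
    (Finset.add_sum_erase _ (fun k => M i k * y k) (Finset.mem_univ i)).symm
  have h2 : ∑ k ∈ Finset.univ.erase i, -M i k * (y k - lo) =
      -(∑ k ∈ Finset.univ.erase i, M i k * y k) - M i i * lo := by
    rw [hM.apply_self i, Finset.sum_mul, ← Finset.sum_neg_distrib, ← Finset.sum_sub_distrib]
    exact Finset.sum_congr rfl fun _ _ => by ring
  simp only [Pi.sub_apply, Pi.smul_apply, smul_eq_mul, h1, h2]
  ring

theorem IsLaplacian.retainsLower (hM : IsLaplacian M) {δ τ ε η : ℝ} (hτ : 0 ≤ τ)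
    (hδ : τ * maxDiag M ≤ 1 - δ) (hδ0 : 0 ≤ δ) (hεδ : ε ≤ δ) (hε : ε ≤ τ * η) (hη : 0 < η)
    (y : Fin n → ℝ) :
    RetainsLower ε (fun i j => η ≤ -M i j) y (y - τ • M.mulVec y) := by
  intro lo hlo i
  have hdiag : δ ≤ 1 - τ * M i i := by
    have := mul_le_mul_of_nonneg_left (le_maxDiag M i) hτ
    linarith
  have hterm : ∀ k ∈ Finset.univ.erase i, 0 ≤ -M i k * (y k - lo) := fun k hk =>
    mul_nonneg (hM.neg_apply_nonneg (Finset.ne_of_mem_erase hk).symm) (sub_nonneg.2 (hlo k))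
  have hsum := mul_nonneg hτ (Finset.sum_nonneg hterm)
  have hself := mul_le_mul_of_nonneg_right hdiag (sub_nonneg.2 (hlo i))
  rw [hM.step_sub]
  refine ⟨?_, fun j hj => ?_⟩
  · have := mul_le_mul_of_nonneg_right hεδ (sub_nonneg.2 (hlo i))
    linarith
  · have hij : i ≠ j := by
      rintro rfl
      linarith [hM.apply_self_nonneg i]
    have h1 : -M i j * (y j - lo) ≤ ∑ k ∈ Finset.univ.erase i, -M i k * (y k - lo) :=
      Finset.single_le_sum hterm (by simp [Ne.symm hij])
    have h2 : ε * (y j - lo) ≤ τ * (-M i j * (y j - lo)) := by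
      rw [← mul_assoc]
      exact mul_le_mul_of_nonneg_right (hε.trans (mul_le_mul_of_nonneg_left hj hτ))
        (sub_nonneg.2 (hlo j))
    have h3 := mul_le_mul_of_nonneg_left h1 hτ
    have h4 := mul_nonneg hδ0 (sub_nonneg.2 (hlo i))
    linarith

end Laplacian

/-! ### From the update times to continuous time. -/

section Trajectory

variable {n : ℕ} {L : ℕ → Matrix (Fin n) (Fin n) ℝ} {t : ℕ → ℝ} {x : ℝ → Fin n → ℝ}

theorem IsSolution.eq_on_Icc (hx : IsSolution L t x) (ht : Monotone t) (k : ℕ) {s : ℝ}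
    (hs : s ∈ Set.Icc (t k) (t (k + 1))) :
    x s = x (t k) - (s - t k) • (L k).mulVec (x (t k)) := by
  refine eq_of_has_deriv_right_eq (f := x)
    (g := fun s => x (t k) - (s - t k) • (L k).mulVec (x (t k)))
    (f' := fun _ => -(L k).mulVec (x (t k))) (hx.hasDeriv k) (fun u _ => ?_)
    (hx.continuousOn.mono fun u hu => (ht (Nat.zero_le k)).trans hu.1) (by fun_prop) (by simp) s hs
  have h1 : HasDerivAt (fun s : ℝ => x (t k) - (s - t k) • (L k).mulVec (x (t k)))
      (-((1 : ℝ) • (L k).mulVec (x (t k)))) u :=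
    ((((hasDerivAt_id u).sub_const (t k)).smul_const _).const_sub _)
  simpa using h1.hasDerivWithinAt

theorem IsSolution.reachesConsensus (hx : IsSolution L t x) [Nonempty (Fin n)] {δ lmin lmax η : ℝ}
    (hδ : δ ∈ Set.Ioo (0 : ℝ) (1 / 2)) (hlmin : 0 < lmin) (hη : 0 < η)
    (hlap : ∀ k, IsLaplacian (L k)) (hdiag : ∀ k, maxDiag (L k) ∈ Set.Icc lmin lmax)
    (ht : ∀ k, t (k + 1) - t k ∈ Set.Icc (δ / maxDiag (L k)) ((1 - δ) / maxDiag (L k)))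
    {T : ℕ} (hT : ∃ᶠ s in atTop, ReachesAll (fun m i j => η ≤ -L m i j) s T) :
    ReachesConsensus x := by
  have hpos : ∀ k, 0 < maxDiag (L k) := fun k => hlmin.trans_le (hdiag k).1
  have hlmax : 0 < lmax := (hpos 0).trans_le (hdiag 0).2
  have hδ0 := hδ.1
  have hstep : ∀ k, δ / lmax ≤ t (k + 1) - t k := fun k =>
    (div_le_div_of_nonneg_left hδ0.le (hpos k) (hdiag k).2).trans (ht k).1
  have hγ : 0 < δ / lmax := div_pos hδ0 hlmax
  have htm : StrictMono t := strictMono_nat_of_lt_succ fun k => by linarith [hstep k]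
  have htlin : ∀ k : ℕ, t 0 + k * (δ / lmax) ≤ t k := fun k => by
    induction k with
    | zero => simp
    | succ k ih => push_cast; linarith [hstep k]
  have htop : Tendsto t atTop atTop := tendsto_atTop_mono htlin
    (tendsto_atTop_add_const_left _ _ (tendsto_natCast_atTop_atTop.atTop_mul_const hγ))
  have hretain : ∀ k s, s ∈ Set.Icc (t k) (t (k + 1)) → ∀ y : Fin n → ℝ, ∀ ε, ε ≤ δ →
      ε ≤ (s - t k) * η →
      RetainsLower ε (fun i j => η ≤ -L k i j) y (y - (s - t k) • (L k).mulVec y) := by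
    intro k s hs y ε hε hε'
    refine (hlap k).retainsLower (sub_nonneg.2 hs.1) ?_ hδ0.le hε hε' hη y
    rw [← le_div_iff₀ (hpos k)]
    linarith [hs.2, (ht k).2]
  have hneg : ∀ k s, s ∈ Set.Icc (t k) (t (k + 1)) →
      -x s = -x (t k) - (s - t k) • (L k).mulVec (-x (t k)) := by
    intro k s hs
    rw [hx.eq_on_Icc htm.monotone k hs, Matrix.mulVec_neg, smul_neg]
    abel
  set ε := min δ (δ / lmax * η)
  have hε : 0 < ε := lt_min hδ0 (mul_pos hγ hη)
  have hε' : ∀ k, ε ≤ (t (k + 1) - t k) * η := fun k =>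
    (min_le_right _ _).trans (mul_le_mul_of_nonneg_right (hstep k) hη.le)
  have hmem : ∀ k, t (k + 1) ∈ Set.Icc (t k) (t (k + 1)) := fun k =>
    Set.right_mem_Icc.2 (htm k.lt_succ_self).le
  obtain ⟨c, hD, hU⟩ := tendsto_of_frequently_reachesAll (y := fun k => x (t k)) hε
    (fun k => by
      rw [hx.eq_on_Icc htm.monotone k (hmem k)]
      exact hretain k _ (hmem k) _ _ (min_le_left _ _) (hε' k))
    (fun k => by
      rw [hneg k _ (hmem k)]
      exact hretain k _ (hmem k) _ _ (min_le_left _ _) (hε' k)) hT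
  refine ⟨c, fun i => Metric.tendsto_atTop.2 fun e he => ?_⟩
  obtain ⟨N, hN⟩ := eventually_atTop.1
    ((hD.eventually_const_lt (sub_lt_self c he)).and (hU.eventually_lt_const (lt_add_of_pos_right c he)))
  refine ⟨t N, fun s hs => ?_⟩
  obtain ⟨k, hNk, hk⟩ : ∃ k, N ≤ k ∧ s ∈ Set.Icc (t k) (t (k + 1)) := by
    obtain ⟨K, hK⟩ := (htop.eventually_gt_atTop s).exists
    have hfind : ∃ K, s < t K := ⟨K, hK⟩
    classical
    have h1 := Nat.find_spec hfind
    have h2 : N < Nat.find hfind := htm.lt_iff_lt.1 (hs.trans_lt h1)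
    obtain ⟨k, hk⟩ : ∃ k, Nat.find hfind = k + 1 :=
      Nat.exists_eq_succ_of_ne_zero (by omega)
    refine ⟨k, by omega, not_lt.1 (Nat.find_min hfind (by omega)), ?_⟩
    rw [← hk]
    exact h1.le
  obtain ⟨h1, h2⟩ := hN k hNk
  -- At an intermediate time the elapsed step may be arbitrarily short, so only `ε = 0` is used: the
  -- bounds at `t k` persist.
  have ha := (hretain k s hk (x (t k)) 0 hδ0.le
    (mul_nonneg (sub_nonneg.2 hk.1) hη.le) _
    (fun j => ciInf_le (Set.finite_range fun i => x (t k) i).bddBelow j) i).1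
  have hb := (hretain k s hk (-x (t k)) 0 hδ0.le
    (mul_nonneg (sub_nonneg.2 hk.1) hη.le) (-⨆ i, x (t k) i)
    (fun j => neg_le_neg (le_ciSup (Set.finite_range fun i => x (t k) i).bddAbove j)) i).1
  rw [← hx.eq_on_Icc htm.monotone k hk] at ha
  rw [← hneg k s hk] at hb
  simp only [Pi.neg_apply, zero_mul] at ha hb
  rw [Real.dist_eq, abs_lt]
  constructor <;> linarith

end Trajectory

/-! ### A tree edge leaving the reached set. -/

section Edge

variable {n : ℕ}

/-- Otherwise the set reached from the root is closed under tree edges and contains every vertex. -/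
theorem HasDeltaSpanningTree.exists_edge {δ : ℝ} {M : Matrix (Fin n) (Fin n) ℝ}
    (H : HasDeltaSpanningTree δ (weightOfLaplacian M)) {g : ℕ → Fin n → Fin n → Prop} {s m : ℕ}
    (hg : ¬ ReachesAll g s m) :
    ∃ i j r, (j, r) ∈ reach g s m ∧ (i, r) ∉ reach g s m ∧ δ ≤ -M i j := by
  obtain ⟨T, hT, r, -, -, hr⟩ := H
  simp only [ReachesAll, not_exists, not_forall] at hg
  obtain ⟨v, hv⟩ := hg r
  by_contra! hcon
  refine hv ?_
  induction hr v with
  | refl => exact refl_mem_reach r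
  | @tail u w _ huw ih =>
    by_cases hu : (u, r) ∈ reach g s m
    · by_contra hw
      have hedge : 0 < deltaMatrix δ (weightOfLaplacian M) w u := hT huw
      have hwu : w ≠ u := fun h => hw (h ▸ hu)
      have := hcon w u r hu hw
      simp [deltaMatrix, weightOfLaplacian, hwu, not_le.2 this] at hedge
    · exact absurd (ih hu) hu

end Edge

/-! ### Measurability of reachability events. -/

section Measurability

variable {Ω κ : Type*} [Finite κ] {m : MeasurableSpace Ω}

theorem measurableSet_setOf_finset {R : Ω → Finset κ} (hR : ∀ p, MeasurableSet {ω | p ∈ R ω})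
    (P : Finset κ → Prop) : MeasurableSet {ω | P (R ω)} := by
  have : {ω | P (R ω)} = ⋃ Q : {Q : Finset κ // P Q}, ⋂ p, {ω | p ∈ R ω ↔ p ∈ Q.1} := by
    ext ω
    simp only [Set.mem_ofPred_eq, Set.mem_iUnion, Set.mem_iInter]
    exact ⟨fun h => ⟨⟨_, h⟩, fun p => Iff.rfl⟩, fun ⟨Q, h⟩ => (Finset.ext h : R ω = Q.1) ▸ Q.2⟩
  rw [this]
  refine MeasurableSet.iUnion fun Q => MeasurableSet.iInter fun p => ?_
  by_cases hp : p ∈ Q.1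
  · simpa [hp] using hR p
  · simpa [hp, Set.compl_ofPred] using (hR p).compl

theorem measurableSet_le_neg {f : Ω → ℝ} (hf : Measurable f) (a : ℝ) :
    MeasurableSet {ω | a ≤ -f ω} :=
  measurableSet_le measurable_const hf.neg

/-- Only the graphs `k + 1, …, k + m` are used, hence `ℱ (k + m)`. -/
theorem measurableSet_mem_reach {ι : Type*} [Fintype ι] [DecidableEq ι] {ℱ : Filtration ℕ m}
    {g : Ω → ℕ → ι → ι → Prop} (hg : ∀ k i j, MeasurableSet[ℱ k] {ω | g ω k i j}) (k m : ℕ) :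
    ∀ p, MeasurableSet[ℱ (k + m)] {ω | p ∈ reach (g ω) (k + 1) m} := by
  induction m with
  | zero =>
    intro p
    simp only [mem_reach_zero]
    exact MeasurableSet.const _
  | succ m ih =>
    intro p
    have hmono := ℱ.mono (Nat.le_succ (k + m))
    simp only [mem_reach_succ, Set.ofPred_or, Set.ofPred_exists, Set.ofPred_and]
    refine (hmono _ (ih p)).union (MeasurableSet.iUnion fun j => (hmono _ (ih _)).inter ?_)
    have := hg (k + 1 + m) p.1 j
    rwa [show k + 1 + m = k + (m + 1) by ring] at this ⊢

end Measurability

/-! ### Conditional probability estimates. -/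

section Probability

variable {Ω : Type*} {m' mΩ : MeasurableSpace Ω} {μ : Measure Ω} [IsProbabilityMeasure μ]

/-- A reverse Markov inequality: over `D` the integral of `X` is at least `a * μ.real D`, while the
part off `E` supplies at most half of it. -/
theorem mul_measureReal_le_of_le_condExp (hm : m' ≤ mΩ) {X : Ω → ℝ}
    (hX : Integrable X μ) {D E : Set Ω} (hD : MeasurableSet[m'] D) (hE : MeasurableSet E) {a C : ℝ}
    (ha : 0 ≤ a) (hXa : ∀ᵐ ω ∂μ, ω ∈ D → a ≤ (μ[X | m']) ω)
    (hXC : ∀ᵐ ω ∂μ, X ω ≤ C) (hXE : ∀ᵐ ω ∂μ, ω ∉ E → X ω ≤ a / 2) :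
    a / 2 * μ.real D ≤ C * μ.real (D ∩ E) := by
  have hD' := hm _ hD
  have h1 : a * μ.real D ≤ ∫ ω in D, X ω ∂μ := by
    rw [← setIntegral_condExp hm hX hD]
    calc a * μ.real D = ∫ _ in D, a ∂μ := by simp [mul_comm]
      _ ≤ _ := setIntegral_mono_on_ae (integrable_const a).integrableOn
          integrable_condExp.integrableOn hD' hXa
  have h2 : ∫ ω in D, X ω ∂μ ≤ ∫ ω in D, (E.indicator (fun _ => C) ω + a / 2) ∂μ := by
    refine setIntegral_mono_ae hX.integrableOn
      (((integrable_const C).indicator hE).add (integrable_const _)).integrableOn ?_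
    filter_upwards [hXC, hXE] with ω h1 h2
    by_cases h : ω ∈ E
    · simp only [h, Set.indicator_of_mem]
      linarith
    · simpa [h] using h2 h
  have h3 : ∫ ω in D, (E.indicator (fun _ => C) ω + a / 2) ∂μ =
      C * μ.real (D ∩ E) + a / 2 * μ.real D := by
    rw [integral_add ((integrable_const C).indicator hE).integrableOn
      (integrable_const _).integrableOn, setIntegral_indicator hE]
    simp [mul_comm]
  linarith

/-- Missing `N` consecutive events has probability at most `(1 - p) ^ N`, since the misses so far
form an admissible `A`. -/
theorem ae_frequently_mem_of_mul_measureReal_le {m : ℕ → MeasurableSpace Ω} (hm : Monotone m)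
    (hmΩ : ∀ q, m q ≤ mΩ) {H : ℕ → Set Ω} (hH : ∀ q, MeasurableSet[m (q + 1)] (H q)) {p : ℝ}
    (hp : 0 < p)
    (hpH : ∀ q A, MeasurableSet[m q] A → p * μ.real A ≤ μ.real (A ∩ H q)) :
    ∀ᵐ ω ∂μ, ∃ᶠ q in atTop, ω ∈ H q := by
  have hp1 : p ≤ 1 := by
    have := hpH 0 Set.univ MeasurableSet.univ
    rw [probReal_univ, mul_one] at this
    exact this.trans measureReal_le_one
  have key : ∀ q₀, μ {ω | ∀ q, ω ∉ H (q₀ + q)} = 0 := by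
    intro q₀
    have hB : ∀ N, MeasurableSet[m (q₀ + N)] {ω | ∀ q < N, ω ∉ H (q₀ + q)} ∧
        μ.real {ω | ∀ q < N, ω ∉ H (q₀ + q)} ≤ (1 - p) ^ N := by
      intro N
      induction N with
      | zero => simp
      | succ N ih =>
        have hsplit : {ω | ∀ q < N + 1, ω ∉ H (q₀ + q)} =
            {ω | ∀ q < N, ω ∉ H (q₀ + q)} \ H (q₀ + N) := by
          ext ω
          simp only [Set.mem_ofPred_eq, Set.mem_sdiff, Nat.forall_lt_succ_right]
        rw [hsplit]
        refine ⟨(hm (Nat.le_succ (q₀ + N)) _ ih.1).diff (hH (q₀ + N)), ?_⟩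
        have h1 := hpH _ _ ih.1
        have h2 := measureReal_inter_add_sdiff (μ := μ) (s := {ω | ∀ q < N, ω ∉ H (q₀ + q)})
          (hmΩ _ _ (hH (q₀ + N)))
        have h3 := mul_le_mul_of_nonneg_left ih.2 (sub_nonneg.2 hp1)
        rw [pow_succ']
        linarith
    have hle : ∀ N, μ.real {ω | ∀ q, ω ∉ H (q₀ + q)} ≤ (1 - p) ^ N := by
      intro N
      refine (measureReal_mono ?_).trans (hB N).2
      intro ω hω q _
      exact hω q
    have hlim := tendsto_pow_atTop_nhds_zero_of_lt_one (sub_nonneg.2 hp1) (by linarith : 1 - p < 1)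
    have h0 := ge_of_tendsto' hlim hle
    exact (measureReal_eq_zero_iff).1 (le_antisymm h0 measureReal_nonneg)
  have hall : ∀ᵐ ω ∂μ, ∀ q₀, ¬ ∀ q, ω ∉ H (q₀ + q) := ae_all_iff.2 fun q₀ => by
    rw [ae_iff]
    simpa using key q₀
  filter_upwards [hall] with ω hω
  refine frequently_atTop.2 fun q₀ => ?_
  obtain ⟨q, hq⟩ := not_forall.1 (hω q₀)
  exact ⟨q₀ + q, Nat.le_add_right _ _, not_not.1 hq⟩

end Probability

/-! ### Random graphs reach all vertices infinitely often. -/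

section RandomGraphs

variable {Ω : Type*} {mΩ : MeasurableSpace Ω} {μ : Measure Ω} [IsProbabilityMeasure μ] {n : ℕ}
  {ℱ : Filtration ℕ mΩ} {L : ℕ → Ω → Matrix (Fin n) (Fin n) ℝ} {lmax δ' : ℝ} {h : ℕ}

theorem measurableSet_le_neg_apply (hadapted : ∀ i j, Adapted ℱ (fun k ω => L k ω i j)) (η : ℝ)
    (k : ℕ) (i j : Fin n) : MeasurableSet[ℱ k] {ω | η ≤ -L k ω i j} :=
  measurableSet_le_neg (m := ℱ k) (hadapted i j k) η

theorem integrable_laplacian_apply (hadapted : ∀ i j, Adapted ℱ (fun k ω => L k ω i j))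
    (hlap : ∀ᵐ ω ∂μ, ∀ k, IsLaplacian (L k ω)) (hdiag : ∀ᵐ ω ∂μ, ∀ k, maxDiag (L k ω) ≤ lmax)
    (k : ℕ) (i j : Fin n) : Integrable (fun ω => L k ω i j) μ := by
  refine Integrable.of_bound ((hadapted i j k).mono (ℱ.le k) le_rfl).aestronglyMeasurable lmax ?_
  filter_upwards [hlap, hdiag] with ω h1 h2
  exact ((h1 k).abs_apply_le i j).trans (h2 k)

/-- An edge of the conditional expected graph is present in the window with conditional probability
bounded below. -/
theorem mul_measureReal_le_of_edge (hadapted : ∀ i j, Adapted ℱ (fun k ω => L k ω i j))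
    (hlap : ∀ᵐ ω ∂μ, ∀ k, IsLaplacian (L k ω)) (hdiag : ∀ᵐ ω ∂μ, ∀ k, maxDiag (L k ω) ≤ lmax)
    (hh : 0 < h) (hδ' : 0 ≤ δ') (k : ℕ) (i j : Fin n) {D : Set Ω}
    (hD : MeasurableSet[ℱ k] D)
    (hDc : ∀ ω ∈ D, δ' ≤ -condExpMatrix μ (ℱ k)
      (fun ω' => ∑ m ∈ Finset.Icc (k + 1) (k + h), L m ω') ω i j) :
    δ' / 2 * μ.real D ≤ h * lmax *
      μ.real (D ∩ {ω | ∃ m ∈ Finset.Icc (k + 1) (k + h), δ' / (2 * h) ≤ -L m ω i j}) := by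
  have hh' : (0 : ℝ) < h := Nat.cast_pos.2 hh
  have hcard : ∀ c : ℝ, ∑ _m ∈ Finset.Icc (k + 1) (k + h), c = h * c := fun c => by
    simp [Finset.sum_const]
  have hf : Integrable (fun ω => ∑ m ∈ Finset.Icc (k + 1) (k + h), L m ω i j) μ :=
    integrable_finsetSum _ fun m _ => integrable_laplacian_apply hadapted hlap hdiag m i j
  refine mul_measureReal_le_of_le_condExp (ℱ.le k)
    (X := -fun ω => ∑ m ∈ Finset.Icc (k + 1) (k + h), L m ω i j) hf.neg hD ?_ hδ' ?_ ?_ ?_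
  · have : {ω | ∃ m ∈ Finset.Icc (k + 1) (k + h), δ' / (2 * h) ≤ -L m ω i j} =
        ⋃ m ∈ Finset.Icc (k + 1) (k + h), {ω | δ' / (2 * h) ≤ -L m ω i j} := by
      ext ω
      simp
    rw [this]
    exact Finset.measurableSet_biUnion _ fun m _ =>
      ℱ.le m _ (measurableSet_le_neg_apply hadapted _ m i j)
  · filter_upwards [condExp_neg (μ := μ)
      (fun ω => ∑ m ∈ Finset.Icc (k + 1) (k + h), L m ω i j) (ℱ k)] with ω hω hωD
    rw [hω]
    simpa [condExpMatrix, Matrix.sum_apply] using hDc ω hωD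
  · filter_upwards [hlap, hdiag] with ω h1 h2
    rw [Pi.neg_apply, ← Finset.sum_neg_distrib, ← hcard]
    exact Finset.sum_le_sum fun m _ => ((h1 m).neg_apply_le i j).trans (h2 m)
  · refine ae_of_all _ fun ω hω => ?_
    -- Off the event each of the `h` summands is below `δ' / (2h)`.
    have : δ' / 2 = h * (δ' / (2 * h)) := by field_simp
    rw [this, Pi.neg_apply, ← Finset.sum_neg_distrib, ← hcard]
    refine Finset.sum_le_sum fun m hm => ?_
    by_contra! hlt
    exact hω ⟨m, hm, hlt.le⟩

/-- During `b` consecutive windows, some vertex reaches all the vertices or the number of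
reached pairs is at least `b`, with conditional probability bounded below. -/
theorem exists_pow_mul_measureReal_le (hadapted : ∀ i j, Adapted ℱ (fun k ω => L k ω i j))
    (hlap : ∀ᵐ ω ∂μ, ∀ k, IsLaplacian (L k ω)) (hdiag : ∀ᵐ ω ∂μ, ∀ k, maxDiag (L k ω) ≤ lmax)
    (hlmax : 0 < lmax) (hh : 0 < h) (hδ' : 0 < δ')
    (htree : ∀ k, ∀ᵐ ω ∂μ, HasDeltaSpanningTree δ' (weightOfLaplacian
      (condExpMatrix μ (ℱ k) (fun ω' => ∑ m ∈ Finset.Icc (k + 1) (k + h), L m ω') ω))) :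
    ∃ c : ℝ, 0 < c ∧ ∀ b k A, MeasurableSet[ℱ k] A → c ^ b * μ.real A ≤ μ.real (A ∩ {ω |
      ReachesAll (fun m i j => δ' / (2 * h) ≤ -L m ω i j) (k + 1) (b * h) ∨
      b ≤ (reach (fun m i j => δ' / (2 * h) ≤ -L m ω i j) (k + 1) (b * h)).card}) := by
  have hh' : (0 : ℝ) < h := Nat.cast_pos.2 hh
  set g : Ω → ℕ → Fin n → Fin n → Prop := fun ω m i j => δ' / (2 * h) ≤ -L m ω i j
  set N : ℝ := (Fintype.card (Fin n × Fin n) : ℝ) + 1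
  have hN : 0 < N := by positivity
  have hC : 0 < h * lmax * N := by positivity
  -- `N` pays for the union over edges, its extra `1` keeping it positive when `n = 0`; the cap `1`
  -- serves the case where all vertices are already reached.
  set c := min 1 (δ' / 2 / (h * lmax * N))
  have hc : 0 < c := lt_min one_pos (by positivity)
  refine ⟨c, hc, fun b k A hA => ?_⟩
  have hgm : ∀ k i j, MeasurableSet[ℱ k] {ω | g ω k i j} :=
    measurableSet_le_neg_apply hadapted _
  have hRm := measurableSet_mem_reach hgm k
  induction b with
  | zero => simp
  | succ b ih =>
    set K := k + b * h
    have hKm : ∀ P : Finset (Fin n × Fin n) → Prop,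
        MeasurableSet[ℱ K] {ω | P (reach (g ω) (k + 1) (b * h))} := fun P =>
      measurableSet_setOf_finset (m := ℱ K) (hRm (b * h)) P
    set U : Set Ω := {ω | ReachesAll (g ω) (k + 1) (b * h)}
    have hU : MeasurableSet[ℱ K] U := hKm fun Q => ∃ r, ∀ i, (i, r) ∈ Q
    set G : Set Ω := {ω | ReachesAll (g ω) (k + 1) (b * h) ∨
      b ≤ (reach (g ω) (k + 1) (b * h)).card}
    have hG : MeasurableSet[ℱ K] G :=
      hKm fun Q => (∃ r, ∀ i, (i, r) ∈ Q) ∨ b ≤ Q.card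
    set G' : Set Ω := {ω | ReachesAll (g ω) (k + 1) ((b + 1) * h) ∨
      b + 1 ≤ (reach (g ω) (k + 1) ((b + 1) * h)).card}
    have hbh : b * h ≤ (b + 1) * h := Nat.mul_le_mul_right h b.le_succ
    have hUG : U ⊆ G' := fun ω hω => Or.inl (ReachesAll.mono hbh hω)
    have hAG : MeasurableSet[ℱ K] (A ∩ G) :=
      (ℱ.mono (Nat.le_add_right k (b * h)) _ hA).inter hG
    set M : Ω → Matrix (Fin n) (Fin n) ℝ := condExpMatrix μ (ℱ K)
      (fun ω' => ∑ m ∈ Finset.Icc (K + 1) (K + h), L m ω')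
    -- The leaving edge depends on `ω`, so the event is covered by `ℱ K`-measurable pieces with a
    -- fixed edge.
    let D : Fin n × Fin n → Set Ω := fun e => ((A ∩ G) \ U) ∩
      ({ω | ∃ r, (e.2, r) ∈ reach (g ω) (k + 1) (b * h) ∧ (e.1, r) ∉ reach (g ω) (k + 1) (b * h)} ∩
        {ω | δ' ≤ -M ω e.1 e.2})
    have hD : ∀ e, MeasurableSet[ℱ K] (D e) := fun e =>
      (hAG.diff hU).inter ((hKm fun Q => ∃ r, (e.2, r) ∈ Q ∧ (e.1, r) ∉ Q).inter
        (measurableSet_le_neg (m := ℱ K) stronglyMeasurable_condExp.measurable δ'))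
    have hDle : ∀ e, δ' / 2 * μ.real (D e) ≤ h * lmax * μ.real (((A ∩ G) \ U) ∩ G') := by
      intro e
      refine (mul_measureReal_le_of_edge hadapted hlap hdiag hh hδ'.le K e.1 e.2 (hD e)
        fun ω hω => hω.2.2).trans
        (mul_le_mul_of_nonneg_left (measureReal_mono ?_) (by positivity))
      rintro ω ⟨⟨h1, ⟨r, h2, h3⟩, -⟩, m, hm, hmg⟩
      refine ⟨h1, Or.inr ?_⟩
      rw [Finset.mem_Icc] at hm
      have hb : b ≤ (reach (g ω) (k + 1) (b * h)).card := h1.1.2.resolve_left h1.2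
      refine Nat.succ_le_of_lt (hb.trans_lt
        (card_reach_lt h2 h3 (q := m - (k + 1)) (by omega) ?_ ?_))
      · have : (b + 1) * h = b * h + h := by ring
        omega
      · rwa [Nat.add_sub_cancel' (by omega)]
    have hcover : μ.real ((A ∩ G) \ U) ≤ ∑ e, μ.real (D e) := by
      refine le_trans ?_ (measureReal_iUnion_fintype_le D)
      refine ENNReal.toReal_mono (measure_ne_top _ _) (measure_mono_ae ?_)
      filter_upwards [htree K] with ω hω hωA
      obtain ⟨i, j, r, h1, h2, h3⟩ := hω.exists_edge (g := g ω) (s := k + 1) (m := b * h) hωA.2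
      exact Set.mem_iUnion.2 ⟨(i, j), hωA, ⟨r, h1, h2⟩, h3⟩
    have hnotU : c * μ.real ((A ∩ G) \ U) ≤ μ.real (((A ∩ G) \ U) ∩ G') := by
      have h1 : δ' / 2 * μ.real ((A ∩ G) \ U) ≤
          h * lmax * N * μ.real (((A ∩ G) \ U) ∩ G') := by
        calc δ' / 2 * μ.real ((A ∩ G) \ U) ≤ ∑ e, δ' / 2 * μ.real (D e) := by
              rw [← Finset.mul_sum]
              exact mul_le_mul_of_nonneg_left hcover (by positivity)
          _ ≤ ∑ _e : Fin n × Fin n, h * lmax * μ.real (((A ∩ G) \ U) ∩ G') :=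
              Finset.sum_le_sum fun e _ => hDle e
          _ = (N - 1) * (h * lmax * μ.real (((A ∩ G) \ U) ∩ G')) := by
              rw [Finset.sum_const, nsmul_eq_mul]
              simp [N]
          _ ≤ _ := by
              have : 0 ≤ h * lmax * μ.real (((A ∩ G) \ U) ∩ G') := by positivity
              linarith
      calc c * μ.real ((A ∩ G) \ U) ≤ δ' / 2 / (h * lmax * N) * μ.real ((A ∩ G) \ U) :=
            mul_le_mul_of_nonneg_right (min_le_right _ _) measureReal_nonneg
        _ ≤ _ := by
            rw [div_mul_eq_mul_div, div_le_iff₀ hC]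
            linarith
    have hinU : c * μ.real ((A ∩ G) ∩ U) ≤ μ.real (((A ∩ G) ∩ U) ∩ G') := by
      rw [Set.inter_eq_left.2 (Set.inter_subset_right.trans hUG)]
      exact mul_le_of_le_one_left measureReal_nonneg (min_le_left _ _)
    have hU' : MeasurableSet U := ℱ.le K _ hU
    have hsum := measureReal_inter_add_sdiff (μ := μ) (s := A ∩ G) hU'
    have hsum' := measureReal_inter_add_sdiff (μ := μ) (s := (A ∩ G) ∩ G') hU'
    rw [Set.inter_right_comm, ← Set.sdiff_inter_right_comm] at hsum'
    have hstep : c * μ.real (A ∩ G) ≤ μ.real ((A ∩ G) ∩ G') := by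
      rw [← hsum, ← hsum', mul_add]
      exact add_le_add hinU hnotU
    calc c ^ (b + 1) * μ.real A = c * (c ^ b * μ.real A) := by ring
      _ ≤ c * μ.real (A ∩ G) := mul_le_mul_of_nonneg_left ih hc.le
      _ ≤ μ.real ((A ∩ G) ∩ G') := hstep
      _ ≤ μ.real (A ∩ G') := measureReal_mono (by gcongr; exact Set.inter_subset_left)

theorem ae_frequently_reachesAll (hadapted : ∀ i j, Adapted ℱ (fun k ω => L k ω i j))
    (hlap : ∀ᵐ ω ∂μ, ∀ k, IsLaplacian (L k ω)) (hdiag : ∀ᵐ ω ∂μ, ∀ k, maxDiag (L k ω) ≤ lmax)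
    (hlmax : 0 < lmax) (hh : 0 < h) (hδ' : 0 < δ')
    (htree : ∀ k, ∀ᵐ ω ∂μ, HasDeltaSpanningTree δ' (weightOfLaplacian
      (condExpMatrix μ (ℱ k) (fun ω' => ∑ m ∈ Finset.Icc (k + 1) (k + h), L m ω') ω))) :
    ∃ T, ∀ᵐ ω ∂μ, ∃ᶠ s in atTop,
      ReachesAll (fun m i j => δ' / (2 * h) ≤ -L m ω i j) s T := by
  obtain ⟨c, hc, hcA⟩ :=
    exists_pow_mul_measureReal_le hadapted hlap hdiag hlmax hh hδ' htree
  -- One more than the number of pairs, so the cardinality alternative is impossible.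
  set B := Fintype.card (Fin n × Fin n) + 1
  have hT : 0 < B * h := by positivity
  set g : Ω → ℕ → Fin n → Fin n → Prop := fun ω m i j => δ' / (2 * h) ≤ -L m ω i j
  have hae := ae_frequently_mem_of_mul_measureReal_le (μ := μ) (m := fun q => ℱ (q * (B * h)))
    (H := fun q => {ω | ReachesAll (g ω) (q * (B * h) + 1) (B * h)})
    (fun q q' hq => ℱ.mono (Nat.mul_le_mul_right _ hq)) (fun q => ℱ.le _)
    (fun q => by
      have := measurableSet_setOf_finset (m := ℱ (q * (B * h) + B * h)) (measurableSet_mem_reach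
        (measurableSet_le_neg_apply hadapted (δ' / (2 * h))) (q * (B * h)) (B * h))
        fun Q => ∃ r, ∀ i, (i, r) ∈ Q
      rwa [← Nat.succ_mul] at this)
    (pow_pos hc B) (fun q A hA => by
      refine (hcA B _ A hA).trans (measureReal_mono (Set.inter_subset_inter_right A ?_))
      rintro ω (hω | hω)
      · exact hω
      · have := Finset.card_le_univ (reach (g ω) (q * (B * h) + 1) (B * h))
        exact absurd (hω.trans this) (by omega))
  refine ⟨B * h, hae.mono fun ω hω => frequently_atTop.2 fun s => ?_⟩
  obtain ⟨q, hq, hqω⟩ := frequently_atTop.1 hω s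
  exact ⟨q * (B * h) + 1, by nlinarith, hqω⟩

end RandomGraphs

end SelfTriggered

theorem theorem2 {Ω : Type*} {mΩ : MeasurableSpace Ω} (μ : Measure Ω) [IsProbabilityMeasure μ]
    (n : ℕ)
    -- the random Laplacians, adapted to the filtration
    (ℱ : Filtration ℕ mΩ) (L : ℕ → Ω → Matrix (Fin n) (Fin n) ℝ)
    (hadapted : ∀ i j, Adapted ℱ (fun k ω => L k ω i j))
    (hlap : ∀ᵐ ω ∂μ, ∀ k, SelfTriggered.IsLaplacian (L k ω))
    (lmin lmax : ℝ) (hlmin : 0 < lmin) (hlmax : lmin < lmax)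
    (hdiag : ∀ᵐ ω ∂μ, ∀ k, SelfTriggered.maxDiag (L k ω) ∈ Set.Icc lmin lmax)
    -- the update times
    (t : ℕ → Ω → ℝ) (δ : ℝ) (hδ : δ ∈ Set.Ioo (0 : ℝ) (1 / 2))
    (ht : ∀ᵐ ω ∂μ, ∀ k, t (k + 1) ω - t k ω ∈
      Set.Icc (δ / SelfTriggered.maxDiag (L k ω)) ((1 - δ) / SelfTriggered.maxDiag (L k ω)))
    -- the spanning tree condition
    (h : ℕ) (hh : 0 < h) (δ' : ℝ) (hδ' : 0 < δ')
    (htree : ∀ k, ∀ᵐ ω ∂μ, SelfTriggered.HasDeltaSpanningTree δ'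
      (SelfTriggered.weightOfLaplacian
        (SelfTriggered.condExpMatrix μ (ℱ k)
          (fun ω' => ∑ m ∈ Finset.Icc (k + 1) (k + h), L m ω') ω)))
    -- the trajectories
    (x : Ω → ℝ → Fin n → ℝ)
    (hx : ∀ᵐ ω ∂μ, SelfTriggered.IsSolution (fun k => L k ω) (fun k => t k ω) (x ω)) :
    ∀ᵐ ω ∂μ, SelfTriggered.ReachesConsensus (x ω) := by
  obtain ⟨T, hT⟩ := SelfTriggered.ae_frequently_reachesAll hadapted hlap
    (hdiag.mono fun ω hω k => (hω k).2) (hlmin.trans hlmax) hh hδ' htree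
  have hη : 0 < δ' / (2 * h) := div_pos hδ' (by positivity)
  rcases isEmpty_or_nonempty (Fin n) with hn | hn
  · exact ae_of_all _ fun ω => ⟨0, fun i => isEmptyElim i⟩
  filter_upwards [hT, hlap, hdiag, ht, hx] with ω h1 h2 h3 h4 h5
  exact h5.reachesConsensus hδ hlmin hη h2 h3 h4 h1
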